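/- **Conventions.** For a complex locally convex space $E$ let $E^\star$ be the space of continuous linear functionals with the topology of uniform convergence on totally bounded sets; $E$ is *stereotype* if the canonical map $E\to (E^\star)^\star$ is an isomorphism of topological vector spaces. A *stereotype algebra* is a unital associative algebra $A$ on a stereotype space such that for every compact $K\subseteq A$ and every neighbourhood of zero $U$ there is a neighbourhood of zero $V$ with $K\cdot V\subseteq U$ and $V\cdot K\subseteq U$; it is *involutive* if it carries a continuous conjugate-linear involution with $(ab)^*=b^*a^*$. $\operatorname{Spec}(A)$ is the set of continuous involutive unital characters $t:A\to\mathbb C$ with the topology of uniform convergence on totally bounded sets, and $I_t=\operatorname{Ker} t$. For $A$ commutative, a left $A$-module $X$ on a locally convex space and $n\in\mathbb Z_+$, put $$J^n_t(X)=\bigl(X/\overline{I_t^{\,n+1}\cdot X}\bigr)^{\triangledown},\qquad J^n_A(X)=\bigsqcup_{t\in\operatorname{Spec}(A)}J^n_t(X),\qquad j^n(x)(t)=x+\overline{I_t^{\,n+1}\cdot X},$$ where $\triangledown$ is the pseudocompletion (the least linear subspace of the completion that contains the given space and in which every totally bounded Cauchy net converges), and $J^n_A(X)$ has the topology with base $$W(x,U,p,\varepsilon)=\{\xi:\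 \pi(\xi)\in U,\ p^n_{\pi(\xi)}\bigl(\xi-j^n(x)(\pi(\xi))\bigr)<\varepsilon\},$$ with $x\in X$, $U\subseteq\operatorname{Spec}(A)$ open, $\varepsilon>0$, $p$ a continuous seminorm on $X$, $p^n_t$ the induced (quotient) seminorm on $J^n_t(X)$ and $\pi: J^n_A(X)\to\operatorname{Spec}(A)$ the projection. A *bundle morphism* is a continuous map over $\operatorname{Spec}(A)$ that is linear on each fibre. If $\varphi:A\to B$ is a homomorphism, $B$ is an $A$-module by $a\cdot b=\varphi(a)b$; a *differential operator of order at most $n$* from $A$ to $B$ is a continuous linear map $D:A\to B$ with $[\dots[[D,a_0],a_1]\dots,a_n]=0$ for all $a_0,\dots,a_n\in A$, where $[P,a](x)=P(ax)-\varphi(a)P(x)$. **Theorem.** Let $A$ be a commutative involutive stereotype algebra, $B$ a unital $C^*$-algebra, and $\varphi:A\to B$ a continuous involutive unital homomorphism with $\varphi(A)\subseteq Z(B)$. Let $n\in\mathbb Z_+$. Then for every bundle morphism $\mu:J^n_A(A)\to J^0_A(B)$ there is a unique differential operator $D:A\to B$ of order at most $n$ such that $$j^0(Dx)=\mu\circ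 j^n(x)\qquad\text{for all }x\in A.$$ -/

import Mathlib

open Set Filter Topology

noncomputable section

/-! ### Stereotype spaces and stereotype algebras -/

section Stereotype

variable (E : Type*) [AddCommGroup E] [Module ℂ E] [UniformSpace E]

/-- The stereotype dual `E⋆`: continuous linear functionals on `E` with the topology of uniform
convergence on totally bounded sets. -/
abbrev StereotypeDual : Type _ :=
  UniformConvergenceCLM (RingHom.id ℂ) (E := E) ℂ {S : Set E | TotallyBounded S}

/-- The canonical map `E → E⋆⋆`, `x ↦ (f ↦ f x)`. -/
def stereotypeEval (x : E) : StereotypeDual (StereotypeDual E) :=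
  UniformConvergenceCLM.ofFun (RingHom.id ℂ) ℂ {S : Set (StereotypeDual E) | TotallyBounded S}
    { toFun := fun f => f x
      map_add' := fun _ _ => rfl
      map_smul' := fun _ _ => rfl
      cont := by
        have := UniformConvergenceCLM.continuousEvalConst (RingHom.id ℂ) ℂ
          {S : Set E | TotallyBounded S}
          (eq_univ_of_forall fun y => mem_sUnion.2 ⟨{y}, totallyBounded_singleton y, rfl⟩)
        exact continuous_eval_const (F := StereotypeDual E) x }

/-- A stereotype space: a locally convex space for which the canonical map `E → E⋆⋆` is an
isomorphism (a linear homeomorphism). -/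
structure IsStereotypeSpace : Prop where
  locallyConvex : PolynormableSpace ℂ E
  reflexive : IsHomeomorph (stereotypeEval E)

end Stereotype

/-- A stereotype algebra: a unital associative algebra on a stereotype space, such that for each
compact set `K` and each neighbourhood of zero `U` there is a neighbourhood of zero `V` with
`K · V ⊆ U` and `V · K ⊆ U`. -/
structure IsStereotypeAlgebra (A : Type*) [Ring A] [Algebra ℂ A] [UniformSpace A] : Prop where
  space : IsStereotypeSpace A
  mul : ∀ K : Set A, IsCompact K → ∀ U ∈ 𝓝 (0 : A), ∃ V ∈ 𝓝 (0 : A),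
    (∀ k ∈ K, ∀ v ∈ V, k * v ∈ U) ∧ (∀ k ∈ K, ∀ v ∈ V, v * k ∈ U)

/-! ### Pseudocompletion -/

/-- A subset `S` of a uniform space is pseudocomplete if every totally bounded Cauchy filter
(net) in `S` converges to a point of `S`. -/
def IsPseudocomplete {E : Type*} [UniformSpace E] (S : Set E) : Prop :=
  ∀ T ⊆ S, TotallyBounded T → ∀ F : Filter E, Cauchy F → T ∈ F → ∃ x ∈ S, F ≤ 𝓝 x

section Pseudocompletion

variable (E : Type*) [AddCommGroup E] [Module ℂ E] [UniformSpace E] [IsUniformAddGroup E]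
  [UniformContinuousConstSMul ℂ E]

/-- The pseudocompletion of `E`: the least pseudocomplete linear subspace of the (Hausdorff)
completion of `E` that contains `E`. -/
def pseudoCompletion : Submodule ℂ (UniformSpace.Completion E) :=
  sInf {S | range ((↑) : E → UniformSpace.Completion E) ⊆ S ∧
    IsPseudocomplete (S : Set (UniformSpace.Completion E))}

variable {E} in
/-- The canonical map from `E` to its pseudocompletion. -/
def toPseudoCompletion (x : E) : pseudoCompletion E :=
  ⟨(x : UniformSpace.Completion E),
    (Submodule.mem_sInf).2 fun _ hS => hS.1 (mem_range_self x)⟩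

end Pseudocompletion

/-! ### The involutive spectrum -/

section Spectrum

variable (A : Type*) [CommRing A] [Algebra ℂ A] [StarRing A] [UniformSpace A]

/-- The involutive spectrum `Spec(A)`: continuous involutive unital characters `A → ℂ`. -/
def InvSpec : Type _ := {s : A →⋆ₐ[ℂ] ℂ // Continuous s}

/-- `Spec(A)` carries the topology of uniform convergence on totally bounded sets of `A`. -/
instance : TopologicalSpace (InvSpec A) :=
  TopologicalSpace.induced
    (fun s => UniformOnFun.ofFun {S : Set A | TotallyBounded S} (s.1 : A → ℂ)) inferInstance

variable {A} in
/-- The kernel `I_t` of a character `t`. -/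
def charIdeal (t : InvSpec A) : Ideal A := RingHom.ker t.1

end Spectrum

/-! ### Jet bundles

A left `A`-module structure on the complex vector space `X` is given by the algebra homomorphism
`ρ : A →ₐ[ℂ] Module.End ℂ X`, `a · x = ρ a x`. -/

section Jets

variable {A : Type*} [CommRing A] [Algebra ℂ A] [StarRing A] [UniformSpace A]
variable {X : Type*} [AddCommGroup X] [Module ℂ X] [UniformSpace X] [IsUniformAddGroup X]
  [ContinuousSMul ℂ X]
variable (ρ : A →ₐ[ℂ] Module.End ℂ X) (n : ℕ)

/-- The closed subspace `closure (I_t ^ (n + 1) · X)` of `X`. -/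
def jetKernel (t : InvSpec A) : Submodule ℂ X :=
  (Submodule.span ℂ {y | ∃ a ∈ charIdeal t ^ (n + 1), ∃ x : X, y = ρ a x}).topologicalClosure

/-- The quotient `X / closure (I_t ^ (n + 1) · X)`. -/
def JetQuotient (t : InvSpec A) : Type _ := X ⧸ jetKernel ρ n t

instance (t : InvSpec A) : AddCommGroup (JetQuotient ρ n t) :=
  inferInstanceAs (AddCommGroup (X ⧸ jetKernel ρ n t))

instance (t : InvSpec A) : Module ℂ (JetQuotient ρ n t) :=
  inferInstanceAs (Module ℂ (X ⧸ jetKernel ρ n t))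

/-- The uniform structure of the quotient topology. -/
instance (t : InvSpec A) : UniformSpace (JetQuotient ρ n t) :=
  IsTopologicalAddGroup.rightUniformSpace (X ⧸ jetKernel ρ n t)

instance (t : InvSpec A) : IsUniformAddGroup (JetQuotient ρ n t) :=
  isUniformAddGroup_of_addCommGroup (G := X ⧸ jetKernel ρ n t)

instance (t : InvSpec A) : UniformContinuousConstSMul ℂ (JetQuotient ρ n t) :=
  haveI : ContinuousConstSMul ℂ (JetQuotient ρ n t) :=
    inferInstanceAs (ContinuousConstSMul ℂ (X ⧸ jetKernel ρ n t))
  uniformContinuousConstSMul_of_continuousConstSMul _ _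

/-- The class of `x` in `X / closure (I_t ^ (n + 1) · X)`. -/
def jetMk (t : InvSpec A) (x : X) : JetQuotient ρ n t := (jetKernel ρ n t).mkQ x

/-- The fibre over `t`: the jet module
`J_t^n(X)`, which is the pseudocompletion of `X / closure (I_t ^ (n + 1) · X)`. -/
abbrev JetFiber (t : InvSpec A) : Type _ := pseudoCompletion (JetQuotient ρ n t)

/-- The jet of `x` at `t`, as an element of the fibre over `t`. -/
def jetAt (x : X) (t : InvSpec A) : JetFiber ρ n t := toPseudoCompletion (jetMk ρ n t x)

/-- The quotient seminorm `p(ξ) = inf {p x | x ∈ ξ}` on `X / closure (I_t ^ (n + 1) · X)`. -/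
def quotientSeminorm (p : Seminorm ℂ X) (t : InvSpec A) (ξ : JetQuotient ρ n t) : ℝ :=
  sInf (p '' {x | jetMk ρ n t x = ξ})

/-- The seminorm `p_t^n` on the fibre `J_t^n(X)`: the continuous extension of the quotient seminorm
to the (pseudo)completion. -/
def jetSeminorm (p : Seminorm ℂ X) (t : InvSpec A) (ξ : JetFiber ρ n t) : ℝ :=
  UniformSpace.Completion.extension (quotientSeminorm ρ n p t)
    (ξ : UniformSpace.Completion (JetQuotient ρ n t))

/-- The jet bundle `J_A^n(X)`: the disjoint union of the fibres `J_t^n(X)`, `t ∈ Spec(A)`, with the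
projection `JetBundle.base` onto `Spec(A)`. -/
@[ext]
structure JetBundle where
  base : InvSpec A
  vec : JetFiber ρ n base

/-- The section `j^n(x) : Spec(A) → J_A^n(X)`. -/
def jet (x : X) (t : InvSpec A) : JetBundle ρ n := ⟨t, jetAt ρ n x t⟩

/-- The basic open set `W(x, U, p, ε)` of the jet bundle. -/
def jetBasicOpen (x : X) (U : Set (InvSpec A)) (p : Seminorm ℂ X) (ε : ℝ) : Set (JetBundle ρ n) :=
  {ξ | ξ.base ∈ U ∧ jetSeminorm ρ n p ξ.base (ξ.vec - jetAt ρ n x ξ.base) < ε}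

/-- The topology of the jet bundle, with the base of open sets `W(x, U, p, ε)`, where `x ∈ X`,
`U ⊆ Spec(A)` is open, `p` is a continuous seminorm on `X` and `ε > 0`. -/
instance : TopologicalSpace (JetBundle ρ n) :=
  TopologicalSpace.generateFrom
    {W | ∃ (x : X) (U : Set (InvSpec A)) (p : Seminorm ℂ X) (ε : ℝ),
      IsOpen U ∧ Continuous p ∧ 0 < ε ∧ W = jetBasicOpen ρ n x U p ε}

end Jets

section Operators

variable {A : Type*} [CommRing A] [Algebra ℂ A] [StarRing A] [UniformSpace A]
variable {X : Type*} [AddCommGroup X] [Module ℂ X] [UniformSpace X] [IsUniformAddGroup X]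
  [ContinuousSMul ℂ X]
variable {Y : Type*} [AddCommGroup Y] [Module ℂ Y] [UniformSpace Y] [IsUniformAddGroup Y]
  [ContinuousSMul ℂ Y]

/-- A morphism of jet bundles `J_A^n(X) → J_A^m(Y)`: a continuous map over `Spec(A)` that is linear
on each fibre. -/
structure JetBundleHom (ρ : A →ₐ[ℂ] Module.End ℂ X) (n : ℕ) (τ : A →ₐ[ℂ] Module.End ℂ Y) (m : ℕ)
    where
  toFun : JetBundle ρ n → JetBundle τ m
  fiberMap : ∀ t : InvSpec A, JetFiber ρ n t →ₗ[ℂ] JetFiber τ m t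
  toFun_mk : ∀ (t : InvSpec A) (ξ : JetFiber ρ n t), toFun ⟨t, ξ⟩ = ⟨t, fiberMap t ξ⟩
  continuous_toFun : Continuous toFun

/-- The commutator `[P, a](x) = P (a · x) - a · P x`. -/
def moduleCommutator (ρ : A →ₐ[ℂ] Module.End ℂ X) (τ : A →ₐ[ℂ] Module.End ℂ Y)
    (P : X →ₗ[ℂ] Y) (a : A) : X →ₗ[ℂ] Y :=
  P ∘ₗ ρ a - τ a ∘ₗ P

/-- `D` is a differential operator of order at most `n`: `D` is linear and continuous, and
`[...[[D, a_0], a_1], ..., a_n] = 0` for all `a_0, ..., a_n ∈ A`. -/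
def IsDiffOp (ρ : A →ₐ[ℂ] Module.End ℂ X) (τ : A →ₐ[ℂ] Module.End ℂ Y) (n : ℕ)
    (D : X →L[ℂ] Y) : Prop :=
  ∀ l : List A, l.length = n + 1 →
    l.foldl (moduleCommutator ρ τ) (D : X →ₗ[ℂ] Y) = 0

end Operators

/-- The algebra `A` as a left module over itself. -/
abbrev selfAction (A : Type*) [CommRing A] [Algebra ℂ A] : A →ₐ[ℂ] Module.End ℂ A :=
  Algebra.lmul ℂ A

/-- The left `A`-module structure `a · y = φ(a) y` on `B` given by a homomorphism `φ : A → B`. -/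
abbrev pullbackAction {A B : Type*} [CommRing A] [Algebra ℂ A] [StarRing A] [CStarAlgebra B]
    (φ : A →⋆ₐ[ℂ] B) : A →ₐ[ℂ] Module.End ℂ B :=
  (Algebra.lmul ℂ B).comp φ.toAlgHom

end

/-!
Since `φ(A)` is central, the closure of `φ(A)` is a copy of some `C(K)`, every point of `K`
restricts to a point of `Spec(A)`, and the fibres of `J_A^0(B)` away from these points vanish.
Cutting off by a function on `K` that peaks at a point shows that the norm of `u ∈ C(K)` is the
supremum of its fibre norms; adjoining the element `star b * b`, which commutes with `φ(A)`, and
using the C⋆-identity, the same holds for every `b ∈ B`. Elements of `B` approximating a continuous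
section of `J_A^0(B)` near each point are glued by a partition of unity on the compact space `K`,
and completeness of `B` then makes every continuous section equal to `j^0(b)` for a unique `b`.

For `x ∈ A` the section `μ ∘ j^n(x)` is continuous, and `D x` is the element of `B` it determines.
At a point `t` every `a` may be replaced by `a - t(a) ∈ I_t` in the commutators, so the
`(n + 1)`-fold commutators of `D` agree on the fibre over `t` with the values of `D` on
`I_t^(n + 1) · A`, which `j^n` kills.
-/

noncomputable section

section QuotientSeminorm

variable {𝕜 M : Type*} [NormedField 𝕜] [AddCommGroup M] [Module 𝕜 M]

/-- The seminorm `ξ ↦ inf {p x | x ∈ ξ}` induced by `p` on the quotient `M ⧸ S`. -/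
def seminormOnQuotient (p : Seminorm 𝕜 M) (S : Submodule 𝕜 M) : Seminorm 𝕜 (M ⧸ S) :=
  letI := p.toSeminormedAddCommGroup
  letI : NormedSpace 𝕜 M := ⟨fun c x => (map_smul_eq_mul p c x).le⟩
  normSeminorm 𝕜 (M ⧸ S)

theorem seminormOnQuotient_lt_iff {p : Seminorm 𝕜 M} {S : Submodule 𝕜 M} {ξ : M ⧸ S} {r : ℝ} :
    seminormOnQuotient p S ξ < r ↔ ∃ x, S.mkQ x = ξ ∧ p x < r :=
  letI := p.toSeminormedAddCommGroup
  QuotientAddGroup.norm_lt_iff (S := S.toAddSubgroup)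

end QuotientSeminorm

section Jets

variable {A : Type*} [CommRing A] [Algebra ℂ A] [StarRing A] [UniformSpace A]

theorem InvSpec.continuous_apply (a : A) : Continuous fun t : InvSpec A => t.1 a :=
  (UniformOnFun.uniformContinuous_eval_of_mem ℂ {S : Set A | TotallyBounded S} (mem_singleton a)
    (totallyBounded_singleton a)).continuous.comp continuous_induced_dom

theorem sub_algebraMap_mem_charIdeal (t : InvSpec A) (a : A) :
    a - algebraMap ℂ A (t.1 a) ∈ charIdeal t := by
  rw [charIdeal, RingHom.mem_ker, map_sub, AlgHomClass.commutes, Algebra.algebraMap_self_apply,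
    sub_self]

variable {X : Type*} [AddCommGroup X] [Module ℂ X] [UniformSpace X] [IsUniformAddGroup X]
  [ContinuousSMul ℂ X]
variable {Y : Type*} [AddCommGroup Y] [Module ℂ Y] [TopologicalSpace Y]
variable (ρ : A →ₐ[ℂ] Module.End ℂ X) (n : ℕ)

theorem apply_mem_jetKernel {t : InvSpec A} {a : A} (ha : a ∈ charIdeal t ^ (n + 1)) (x : X) :
    ρ a x ∈ jetKernel ρ n t :=
  Submodule.le_topologicalClosure _ (Submodule.subset_span ⟨a, ha, x, rfl⟩)

theorem isClosed_jetKernel (t : InvSpec A) : IsClosed (jetKernel ρ n t : Set X) :=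
  Submodule.isClosed_topologicalClosure _

variable {ρ n} in
theorem jetKernel_le_comap {σ : ℂ →+* ℂ} {t : InvSpec A} {T : X →SL[σ] Y} {S : Submodule ℂ Y}
    (hS : IsClosed (S : Set Y)) (h : ∀ a ∈ charIdeal t ^ (n + 1), ∀ x, T (ρ a x) ∈ S) :
    jetKernel ρ n t ≤ S.comap T.toLinearMap := by
  refine Submodule.topologicalClosure_minimal _ (Submodule.span_le.2 ?_) (hS.preimage T.continuous)
  rintro _ ⟨a, ha, x, rfl⟩
  exact h a ha x

/-- The linear map `x ↦ j^n(x)(t)`. -/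
def jetAtₗ (t : InvSpec A) : X →ₗ[ℂ] JetFiber ρ n t where
  toFun x := jetAt ρ n x t
  map_add' x y :=
    Subtype.ext (UniformSpace.Completion.coe_add (jetMk ρ n t x) (jetMk ρ n t y))
  map_smul' c x := Subtype.ext (UniformSpace.Completion.coe_smul c (jetMk ρ n t x))

theorem ker_jetAtₗ (t : InvSpec A) : LinearMap.ker (jetAtₗ ρ n t) = jetKernel ρ n t := by
  have : IsClosed (jetKernel ρ n t : Set X) := isClosed_jetKernel ρ n t
  have : T0Space (JetQuotient ρ n t) := inferInstanceAs (T0Space (X ⧸ jetKernel ρ n t))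
  ext x
  rw [LinearMap.mem_ker, ← Submodule.Quotient.mk_eq_zero, ← ZeroMemClass.coe_eq_zero]
  exact UniformSpace.Completion.coe_eq_zero_iff

variable {ρ n} in
theorem jetAt_eq_jetAt_iff {t : InvSpec A} {x y : X} :
    jetAt ρ n x t = jetAt ρ n y t ↔ x - y ∈ jetKernel ρ n t := by
  rw [← ker_jetAtₗ]
  exact (LinearMap.sub_mem_ker_iff (f := jetAtₗ ρ n t)).symm

theorem jetAt_surjective [FirstCountableTopology X] [CompleteSpace X] (t : InvSpec A) :
    Function.Surjective fun x => jetAt ρ n x t := by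
  intro ξ
  have : CompleteSpace (JetQuotient ρ n t) :=
    QuotientAddGroup.completeSpace_right X (jetKernel ρ n t).toAddSubgroup
  have hclosed := (UniformSpace.Completion.isUniformInducing_coe
    (JetQuotient ρ n t)).isComplete_range.isClosed
  obtain ⟨η, hη⟩ := hclosed.closure_eq.le (UniformSpace.Completion.denseRange_coe ξ.1)
  obtain ⟨x, rfl⟩ := (jetKernel ρ n t).mkQ_surjective η
  exact ⟨x, Subtype.ext hη⟩

/-- The seminorm `x ↦ p_t^n(j^n(x)(t))` on `X`. -/
def fiberSeminorm (p : Seminorm ℂ X) (t : InvSpec A) : Seminorm ℂ X :=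
  (seminormOnQuotient p (jetKernel ρ n t)).comp (jetKernel ρ n t).mkQ

variable {ρ n} {p : Seminorm ℂ X} {t : InvSpec A} {x y : X}

theorem quotientSeminorm_jetMk (p : Seminorm ℂ X) (t : InvSpec A) (x : X) :
    quotientSeminorm ρ n p t (jetMk ρ n t x) = fiberSeminorm ρ n p t x := by
  have hbdd : BddBelow (p '' {y | jetMk ρ n t y = jetMk ρ n t x}) :=
    ⟨0, forall_mem_image.2 fun y _ => apply_nonneg p y⟩
  refine eq_of_forall_gt_iff fun r => ?_
  rw [quotientSeminorm, csInf_lt_iff hbdd ⟨p x, mem_image_of_mem p rfl⟩, exists_mem_image]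
  exact seminormOnQuotient_lt_iff.symm

theorem fiberSeminorm_lt_iff {r : ℝ} :
    fiberSeminorm ρ n p t x < r ↔ ∃ y ∈ jetKernel ρ n t, p (x + y) < r := by
  refine seminormOnQuotient_lt_iff.trans ⟨?_, ?_⟩
  · rintro ⟨z, hz, hpz⟩
    exact ⟨z - x, (Submodule.Quotient.eq _).1 hz, by rwa [add_sub_cancel]⟩
  · rintro ⟨y, hy, hpy⟩
    exact ⟨x + y, (Submodule.Quotient.eq _).2 (by rwa [add_sub_cancel_left]), hpy⟩

theorem fiberSeminorm_le (p : Seminorm ℂ X) (t : InvSpec A) (x : X) :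
    fiberSeminorm ρ n p t x ≤ p x :=
  le_of_forall_gt fun _ hr => fiberSeminorm_lt_iff.2 ⟨0, zero_mem _, by rwa [add_zero]⟩

theorem fiberSeminorm_congr (h : x - y ∈ jetKernel ρ n t) :
    fiberSeminorm ρ n p t x = fiberSeminorm ρ n p t y :=
  congrArg (seminormOnQuotient p (jetKernel ρ n t)) ((Submodule.Quotient.eq _).2 h)

theorem fiberSeminorm_eq_zero_of_mem (h : x ∈ jetKernel ρ n t) : fiberSeminorm ρ n p t x = 0 := by
  rw [fiberSeminorm_congr (y := 0) (by rwa [sub_zero]), map_zero]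

theorem jetSeminorm_jetAt (hp : Continuous p) (t : InvSpec A) (x : X) :
    jetSeminorm ρ n p t (jetAt ρ n x t) = fiberSeminorm ρ n p t x := by
  have hcont : Continuous (seminormOnQuotient p (jetKernel ρ n t)) :=
    (jetKernel ρ n t).isOpenQuotientMap_mkQ.isQuotientMap.continuous_iff.2
      (Seminorm.continuous_of_le (p := fiberSeminorm ρ n p t) hp (fiberSeminorm_le p t))
  have heq : quotientSeminorm ρ n p t = seminormOnQuotient p (jetKernel ρ n t) :=
    funext ((jetKernel ρ n t).mkQ_surjective.forall.2 (quotientSeminorm_jetMk p t))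
  have hunif : UniformContinuous (quotientSeminorm ρ n p t) := by
    rw [heq]
    exact Seminorm.uniformContinuous_of_continuousAt_zero (E := JetQuotient ρ n t)
      hcont.continuousAt
  exact (UniformSpace.Completion.extension_coe hunif _).trans (quotientSeminorm_jetMk p t x)

theorem jet_mem_jetBasicOpen_iff {U : Set (InvSpec A)} (hp : Continuous p) {ε : ℝ} :
    jet ρ n x t ∈ jetBasicOpen ρ n y U p ε ↔ t ∈ U ∧ fiberSeminorm ρ n p t (x - y) < ε := by
  rw [← jetSeminorm_jetAt hp]
  exact and_congr_right' (iff_of_eq (congrArg (jetSeminorm ρ n p t · < ε)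
    (map_sub (jetAtₗ ρ n t) x y).symm))

theorem isOpen_jetBasicOpen (x : X) {U : Set (InvSpec A)} (hU : IsOpen U) (hp : Continuous p)
    {ε : ℝ} (hε : 0 < ε) : IsOpen (jetBasicOpen ρ n x U p ε) :=
  TopologicalSpace.isOpen_generateFrom_of_mem ⟨x, U, p, ε, hU, hp, hε, rfl⟩

variable (ρ) in
theorem exists_family_mem_charIdeal_pow {m : ℕ} {a : A} (ha : a ∈ charIdeal t ^ m) :
    ∃ α : InvSpec A → A, α t = a ∧ (∀ s, α s ∈ charIdeal s ^ m) ∧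
      ∀ x : X, Continuous fun s => ρ (α s) x := by
  induction ha using Submodule.pow_induction_on_right' with
  | algebraMap r =>
    exact ⟨fun _ => r, rfl, fun s => by simp, fun x => continuous_const⟩
  | add a b m _ _ iha ihb =>
    obtain ⟨α, rfl, hα, hαc⟩ := iha
    obtain ⟨β, rfl, hβ, hβc⟩ := ihb
    refine ⟨α + β, rfl, fun s => add_mem (hα s) (hβ s), fun x => ?_⟩
    exact ((hαc x).add (hβc x)).congr fun s => by simp
  | mul_mem m a _ iha c hc =>
    obtain ⟨α, rfl, hα, hαc⟩ := iha
    have htc : t.1 c = 0 := hc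
    -- A factor `c ∈ I_t` is moved into `I_s` by subtracting the constant `s(c)`.
    refine ⟨fun s => α s * (c - algebraMap ℂ A (s.1 c)), by simp [htc],
      fun s => Ideal.mul_mem_mul (hα s) (sub_algebraMap_mem_charIdeal s c), fun x => ?_⟩
    exact ((hαc (ρ c x)).sub ((InvSpec.continuous_apply c).smul (hαc x))).congr fun s => by
      simp [Module.algebraMap_end_apply]

theorem exists_continuousMap_mem_jetKernel
    (hy : y ∈ Submodule.span ℂ {y | ∃ a ∈ charIdeal t ^ (n + 1), ∃ x : X, y = ρ a x}) :
    ∃ ζ : C(InvSpec A, X), ζ t = y ∧ ∀ s, ζ s ∈ jetKernel ρ n s := by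
  induction hy using Submodule.span_induction with
  | mem y hy =>
    obtain ⟨a, ha, x, rfl⟩ := hy
    obtain ⟨α, rfl, hα, hαc⟩ := exists_family_mem_charIdeal_pow ρ ha
    exact ⟨⟨_, hαc x⟩, rfl, fun s => apply_mem_jetKernel ρ n (hα s) x⟩
  | zero => exact ⟨0, rfl, fun s => zero_mem _⟩
  | add y z _ _ hy hz =>
    obtain ⟨η, rfl, hη⟩ := hy
    obtain ⟨ζ, rfl, hζ⟩ := hz
    exact ⟨η + ζ, rfl, fun s => add_mem (hη s) (hζ s)⟩
  | smul c y _ hy =>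
    obtain ⟨η, rfl, hη⟩ := hy
    exact ⟨c • η, rfl, fun s => Submodule.smul_mem _ c (hη s)⟩

theorem upperSemicontinuous_fiberSeminorm (hp : Continuous p) :
    UpperSemicontinuous fun z : X × InvSpec A => fiberSeminorm ρ n p z.2 z.1 := by
  rintro ⟨x, t⟩ r hr
  obtain ⟨y, hy, hpy⟩ := fiberSeminorm_lt_iff.1 hr
  have hopen : IsOpen {y | p (x + y) < r} := isOpen_lt (by fun_prop) continuous_const
  obtain ⟨z, hz, hzspan⟩ := mem_closure_iff.1 hy _ hopen hpy
  obtain ⟨ζ, rfl, hζ⟩ := exists_continuousMap_mem_jetKernel hzspan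
  have hcont : Continuous fun w : X × InvSpec A => p (w.1 + ζ w.2) := by fun_prop
  filter_upwards [hcont.continuousAt.eventually_lt_const hz] with w hw
  exact fiberSeminorm_lt_iff.2 ⟨_, hζ w.2, hw⟩

variable (ρ n) in
theorem continuous_jet : Continuous fun z : X × InvSpec A => jet ρ n z.1 z.2 := by
  refine continuous_generateFrom_iff.2 ?_
  rintro _ ⟨y, U, p, ε, hU, hp, -, rfl⟩
  have husc := (upperSemicontinuous_fiberSeminorm (ρ := ρ) (n := n) hp).isOpen_preimage ε
  simp only [preimage, jet_mem_jetBasicOpen_iff hp]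
  exact (hU.preimage continuous_snd).inter
    (husc.preimage ((continuous_fst.sub continuous_const).prodMk continuous_snd))

end Jets

section Operators

variable {A : Type*} [CommRing A] [Algebra ℂ A] [StarRing A] [UniformSpace A]
variable {X : Type*} [AddCommGroup X] [Module ℂ X]
variable {Y : Type*} [AddCommGroup Y] [Module ℂ Y] [UniformSpace Y] [IsUniformAddGroup Y]
  [ContinuousSMul ℂ Y]
variable {ρ : A →ₐ[ℂ] Module.End ℂ X} {τ : A →ₐ[ℂ] Module.End ℂ Y} {t : InvSpec A}

theorem foldl_moduleCommutator_mem_jetKernel (l : List A) {P : X →ₗ[ℂ] Y}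
    (h : ∀ a ∈ charIdeal t ^ l.length, ∀ x, P (ρ a x) ∈ jetKernel τ 0 t) (x : X) :
    l.foldl (moduleCommutator ρ τ) P x ∈ jetKernel τ 0 t := by
  induction l generalizing P with
  | nil => simpa using h 1 (by simp) x
  | cons b l ih =>
    refine ih fun a ha x => ?_
    have hb := sub_algebraMap_mem_charIdeal t b
    set c := b - algebraMap ℂ A (t.1 b) with hc
    have hcomm : moduleCommutator ρ τ P b (ρ a x) = P (ρ (c * a) x) - τ c (P (ρ a x)) := by
      simp [moduleCommutator, hc, sub_mul]
    rw [hcomm]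
    refine sub_mem (h _ ?_ x) (apply_mem_jetKernel τ 0 (by simpa using hb) _)
    rw [List.length_cons, pow_succ']
    exact Ideal.mul_mem_mul hb ha

end Operators

section ContinuousFunctions

universe u

theorem exists_norm_mul_le_of_apply_eq_zero {K : Type*} [TopologicalSpace K] [CompactSpace K]
    {f : C(K, ℂ)} {k : K} (hf : f k = 0) {δ : ℝ} (hδ : 0 < δ) :
    ∃ e : C(K, ℂ), ‖e‖ ≤ 1 ∧ e k = 1 ∧ ‖e * f‖ ≤ δ := by
  have hpos (l : K) : 0 < δ + ‖f l‖ := by positivity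
  let e : C(K, ℂ) :=
    { toFun := fun l => (δ / (δ + ‖f l‖) : ℝ)
      continuous_toFun := Complex.continuous_ofReal.comp
        (continuous_const.div (by fun_prop) fun l => (hpos l).ne') }
  have hnorm (l : K) : ‖e l‖ = δ / (δ + ‖f l‖) := by
    change ‖((δ / (δ + ‖f l‖) : ℝ) : ℂ)‖ = _
    rw [Complex.norm_real, Real.norm_of_nonneg (div_nonneg hδ.le (hpos l).le)]
  refine ⟨e, (ContinuousMap.norm_le _ zero_le_one).2 fun l => ?_, ?_,
    (ContinuousMap.norm_le _ hδ.le).2 fun l => ?_⟩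
  · rw [hnorm, div_le_one (hpos l)]
    exact le_add_of_nonneg_right (norm_nonneg _)
  · simp [e, hf, hδ.ne']
  · rw [ContinuousMap.mul_apply, norm_mul, hnorm, div_mul_eq_mul_div, div_le_iff₀ (hpos l)]
    gcongr
    exact le_add_of_nonneg_left hδ.le

open scoped IsMulCommutative in
theorem exists_isometry_range_eq_closure {B : Type u} [CStarAlgebra B] (S : StarSubalgebra ℂ B)
    [IsMulCommutative S] :
    ∃ (K : Type u) (_ : TopologicalSpace K) (_ : CompactSpace K) (_ : T2Space K)
      (ι : C(K, ℂ) →⋆ₐ[ℂ] B), Isometry ι ∧ range ι = closure (S : Set B) := by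
  let _ : CommRing S.topologicalClosure := S.commRingTopologicalClosure mul_comm
  have hclosed : IsClosed (S.topologicalClosure : Set B) := S.isClosed_topologicalClosure
  let _ : CommCStarAlgebra S.topologicalClosure := { }
  have hsymm := (gelfandTransform_isometry S.topologicalClosure).right_inv
    (gelfandStarTransform S.topologicalClosure).apply_symm_apply
  refine ⟨WeakDual.characterSpace ℂ S.topologicalClosure, inferInstance, inferInstance,
    inferInstance, S.topologicalClosure.subtype.comp
      (gelfandStarTransform S.topologicalClosure).symm, isometry_subtype_coe.comp hsymm, ?_⟩
  exact ((gelfandStarTransform _).symm.surjective.range_comp _).trans Subtype.range_coe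

theorem exists_continuousMap_factorization {A : Type*} [Semiring A] [StarRing A] [Algebra ℂ A]
    [TopologicalSpace A] {B : Type u} [CStarAlgebra B] {φ : A →⋆ₐ[ℂ] B} (hφ : Continuous φ)
    {S : StarSubalgebra ℂ B} [IsMulCommutative S] (hS : range φ ⊆ S) :
    ∃ (K : Type u) (_ : TopologicalSpace K) (_ : CompactSpace K) (_ : T2Space K)
      (ι : C(K, ℂ) →⋆ₐ[ℂ] B) (ψ : A →⋆ₐ[ℂ] C(K, ℂ)),
      Isometry ι ∧ Continuous ψ ∧ ι.comp ψ = φ ∧ range ι = closure (S : Set B) := by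
  obtain ⟨K, _, _, _, ι, hι, hrange⟩ := exists_isometry_range_eq_closure S
  have hmem (a : A) : φ a ∈ ι.range := (hrange ▸ hS.trans subset_closure) (mem_range_self a)
  let ψ : A →⋆ₐ[ℂ] C(K, ℂ) :=
    ((StarAlgEquiv.ofInjective ι hι.injective).symm : ι.range →⋆ₐ[ℂ] C(K, ℂ)).comp
      (φ.codRestrict ι.range hmem)
  have hιψ : ι.comp ψ = φ := StarAlgHom.ext fun a =>
    congrArg Subtype.val ((StarAlgEquiv.ofInjective ι hι.injective).apply_symm_apply ⟨φ a, hmem a⟩)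
  exact ⟨K, _, ‹_›, ‹_›, ι, ψ, hι,
    hι.isEmbedding.continuous_iff.2 (hφ.congr fun a => (DFunLike.congr_fun hιψ a).symm), hιψ,
    hrange⟩

end ContinuousFunctions

section CentralHom

variable {A : Type*} [CommRing A] [Algebra ℂ A] [StarRing A] [UniformSpace A]
variable {B : Type*} [CStarAlgebra B] (φ : A →⋆ₐ[ℂ] B)

/-- The quotient norm of the fibre `J_t^0(B)`, as a seminorm on `B`. -/
def fiberNorm (t : InvSpec A) : Seminorm ℂ B :=
  fiberSeminorm (pullbackAction φ) 0 (normSeminorm ℂ B) t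

theorem fiberNorm_le_norm (t : InvSpec A) (b : B) : fiberNorm φ t b ≤ ‖b‖ :=
  fiberSeminorm_le (normSeminorm ℂ B) t b

variable {φ} {t : InvSpec A} {b c : B}

theorem fiberNorm_lt_iff {r : ℝ} :
    fiberNorm φ t b < r ↔ ∃ y ∈ jetKernel (pullbackAction φ) 0 t, ‖b + y‖ < r :=
  fiberSeminorm_lt_iff

theorem fiberNorm_eq_zero_iff :
    fiberNorm φ t b = 0 ↔ b ∈ jetKernel (pullbackAction φ) 0 t := by
  refine ⟨fun h => ?_, fiberSeminorm_eq_zero_of_mem⟩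
  refine (isClosed_jetKernel (pullbackAction φ) 0 t).closure_subset
    (Metric.mem_closure_iff.2 fun ε hε => ?_)
  obtain ⟨y, hy, hlt⟩ := fiberNorm_lt_iff.1 (h.trans_lt hε)
  exact ⟨-y, neg_mem hy, by rwa [dist_eq_norm, sub_neg_eq_add]⟩

theorem map_mul_mem_jetKernel {a : A} (ha : a ∈ charIdeal t) (b : B) :
    φ a * b ∈ jetKernel (pullbackAction φ) 0 t :=
  apply_mem_jetKernel (pullbackAction φ) 0 (by simpa using ha) b

theorem jetKernel_pullbackAction_le_comap {σ : ℂ →+* ℂ} {T : B →SL[σ] B}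
    (h : ∀ a ∈ charIdeal t, ∀ b, T (φ a * b) ∈ jetKernel (pullbackAction φ) 0 t) :
    jetKernel (pullbackAction φ) 0 t ≤ (jetKernel (pullbackAction φ) 0 t).comap T.toLinearMap :=
  jetKernel_le_comap (isClosed_jetKernel _ _ t) fun a ha b => h a (by simpa using ha) b

theorem mul_mem_jetKernel_right (hb : b ∈ jetKernel (pullbackAction φ) 0 t) (c : B) :
    b * c ∈ jetKernel (pullbackAction φ) 0 t :=
  jetKernel_pullbackAction_le_comap (T := (ContinuousLinearMap.mul ℂ B).flip c)
    (fun a ha b => by simpa [mul_assoc] using map_mul_mem_jetKernel ha (b * c)) hb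

section Central

variable (hcenter : range φ ⊆ Set.center B)
include hcenter

theorem mul_mem_jetKernel_left (c : B) (hb : b ∈ jetKernel (pullbackAction φ) 0 t) :
    c * b ∈ jetKernel (pullbackAction φ) 0 t := by
  refine jetKernel_pullbackAction_le_comap (T := ContinuousLinearMap.mul ℂ B c)
    (fun a ha b => ?_) hb
  have hcomm : Commute (φ a) c := (hcenter (mem_range_self a)).comm c
  simpa [← hcomm.left_comm] using map_mul_mem_jetKernel ha (c * b)

theorem star_mem_jetKernel (hb : b ∈ jetKernel (pullbackAction φ) 0 t) :
    star b ∈ jetKernel (pullbackAction φ) 0 t := by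
  refine jetKernel_pullbackAction_le_comap (T := (starL ℂ : B ≃L⋆[ℂ] B).toContinuousLinearMap)
    (fun a ha b => ?_) hb
  have hstar : star a ∈ charIdeal t := by
    rw [charIdeal, RingHom.mem_ker] at ha ⊢
    rw [map_star, ha, star_zero]
  have hcomm : Commute (φ (star a)) (star b) := (hcenter (mem_range_self _)).comm _
  simpa [← map_star, ← hcomm.eq] using map_mul_mem_jetKernel hstar (star b)

theorem fiberNorm_star_le : fiberNorm φ t (star b) ≤ fiberNorm φ t b := by
  refine le_of_forall_gt fun r hr => ?_
  obtain ⟨y, hy, hlt⟩ := fiberNorm_lt_iff.1 hr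
  exact fiberNorm_lt_iff.2
    ⟨star y, star_mem_jetKernel hcenter hy, by rwa [← star_add, norm_star]⟩

theorem fiberNorm_mul_le : fiberNorm φ t (b * c) ≤ fiberNorm φ t b * fiberNorm φ t c := by
  refine le_mul_of_forall_lt₀ fun r hr s hs => ?_
  obtain ⟨y, hy, hyr⟩ := fiberNorm_lt_iff.1 hr
  obtain ⟨z, hz, hzs⟩ := fiberNorm_lt_iff.1 hs
  have hsub : b * c - (b + y) * (c + z) ∈ jetKernel (pullbackAction φ) 0 t := by
    rw [show b * c - (b + y) * (c + z) = -(b * z) - y * (c + z) by noncomm_ring]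
    exact sub_mem (neg_mem (mul_mem_jetKernel_left hcenter b hz)) (mul_mem_jetKernel_right hy _)
  calc fiberNorm φ t (b * c) = fiberNorm φ t ((b + y) * (c + z)) := fiberSeminorm_congr hsub
    _ ≤ ‖b + y‖ * ‖c + z‖ := (fiberNorm_le_norm φ t _).trans (norm_mul_le _ _)
    _ ≤ r * s := by gcongr; exact (norm_nonneg _).trans hyr.le

theorem fiberNorm_star_mul_self_le : fiberNorm φ t (star b * b) ≤ fiberNorm φ t b ^ 2 :=
  calc fiberNorm φ t (star b * b) ≤ fiberNorm φ t (star b) * fiberNorm φ t b :=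
        fiberNorm_mul_le hcenter
    _ ≤ fiberNorm φ t b * fiberNorm φ t b := by gcongr; exact fiberNorm_star_le hcenter
    _ = fiberNorm φ t b ^ 2 := (sq _).symm

end Central

end CentralHom

section Points

variable {A : Type*} [CommRing A] [Algebra ℂ A] [StarRing A] [UniformSpace A]
variable {K : Type*} [TopologicalSpace K] [CompactSpace K] {ψ : A →⋆ₐ[ℂ] C(K, ℂ)}

/-- The point of `Spec(A)` induced by a point `k` of the compact space `K` via `ψ : A → C(K)`:
the character `a ↦ ψ(a)(k)`. -/
def InvSpec.ofPoint (hψ : Continuous ψ) (k : K) : InvSpec A :=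
  ⟨(ContinuousMap.evalStarAlgHom ℂ ℂ k).comp ψ, (continuous_eval_const k).comp hψ⟩

theorem InvSpec.continuous_ofPoint [IsUniformAddGroup A] (hψ : Continuous ψ) :
    Continuous (InvSpec.ofPoint hψ) := by
  refine continuous_induced_rng.2 (continuous_iff_continuousAt.2 fun k =>
    UniformOnFun.tendsto_iff_tendstoUniformlyOn.2 fun S hS => ?_)
  have hcompact : IsCompact (closure (ψ '' S)) := TotallyBounded.isCompact_of_isClosed
    (hS.image (uniformContinuous_addMonoidHom_of_continuous hψ)).closure isClosed_closure
  let eval : C(K, C(C(K, ℂ), ℂ)) :=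
    ContinuousMap.curry ⟨fun z : K × C(K, ℂ) => z.2 z.1, by fun_prop⟩
  have hunif := ContinuousMap.tendsto_iff_forall_isCompact_tendstoUniformlyOn.1
    (eval.continuous.tendsto k) _ hcompact
  exact (hunif.comp ψ).mono fun a ha => subset_closure (mem_image_of_mem ψ ha)

variable {B : Type*} [CStarAlgebra B] {ι : C(K, ℂ) →⋆ₐ[ℂ] B} {k : K}

theorem exists_norm_mul_le_of_mem_span (hι : Isometry ι) (hψ : Continuous ψ) {y : B}
    (hy : y ∈ Submodule.span ℂ {y | ∃ a ∈ charIdeal (InvSpec.ofPoint hψ k) ^ (0 + 1),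
      ∃ b : B, y = pullbackAction (ι.comp ψ) a b}) {δ : ℝ} (hδ : 0 < δ) :
    ∃ e : C(K, ℂ), ‖e‖ ≤ 1 ∧ e k = 1 ∧ ‖ι e * y‖ ≤ δ := by
  have hnorm (f : C(K, ℂ)) : ‖ι f‖ = ‖f‖ := hι.norm_map_of_map_zero (map_zero ι) f
  induction hy using Submodule.closure_induction generalizing δ with
  | zero =>
    exact ⟨1, (ContinuousMap.norm_le _ zero_le_one).2 fun l => by simp, rfl, by simpa using hδ.le⟩
  | add y z _ _ hy hz =>
    obtain ⟨e, he, hek, hey⟩ := hy (half_pos hδ)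
    obtain ⟨f, hf, hfk, hfz⟩ := hz (half_pos hδ)
    refine ⟨e * f, (norm_mul_le e f).trans (mul_le_one₀ he (norm_nonneg f) hf),
      by simp [hek, hfk], ?_⟩
    calc ‖ι (e * f) * (y + z)‖ = ‖ι f * (ι e * y) + ι e * (ι f * z)‖ := by
          rw [mul_add, ← mul_assoc, ← mul_assoc, ← map_mul, ← map_mul, mul_comm f e]
      _ ≤ ‖ι f‖ * ‖ι e * y‖ + ‖ι e‖ * ‖ι f * z‖ :=
        norm_add_le_of_le (norm_mul_le _ _) (norm_mul_le _ _)
      _ ≤ 1 * (δ / 2) + 1 * (δ / 2) := by rw [hnorm, hnorm]; gcongr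
      _ = δ := by ring
  | smul_mem c y hy =>
    obtain ⟨a, ha, b, rfl⟩ := hy
    rw [zero_add, pow_one] at ha
    have hak : ψ a k = 0 := ha
    have hpos : 0 < ‖c • b‖ + 1 := by positivity
    obtain ⟨e, he, hek, hea⟩ := exists_norm_mul_le_of_apply_eq_zero hak (div_pos hδ hpos)
    refine ⟨e, he, hek, ?_⟩
    calc ‖ι e * (c • (ι (ψ a) * b))‖ = ‖ι (e * ψ a) * (c • b)‖ := by
          rw [map_mul, mul_assoc, mul_smul_comm c (ι (ψ a))]
      _ ≤ δ / (‖c • b‖ + 1) * (‖c • b‖ + 1) :=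
        (norm_mul_le _ _).trans (by rw [hnorm]; gcongr; linarith)
      _ = δ := div_mul_cancel₀ _ hpos.ne'

theorem norm_apply_le_fiberNorm (hι : Isometry ι) (hψ : Continuous ψ) (u : C(K, ℂ)) (k : K) :
    ‖u k‖ ≤ fiberNorm (ι.comp ψ) (InvSpec.ofPoint hψ k) (ι u) := by
  have hnorm (f : C(K, ℂ)) : ‖ι f‖ = ‖f‖ := hι.norm_map_of_map_zero (map_zero ι) f
  have hclosed : IsClosed {y | ‖u k‖ ≤ ‖ι u + y‖} := isClosed_le (by fun_prop) (by fun_prop)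
  refine le_of_forall_gt fun r hr => ?_
  obtain ⟨y, hy, hlt⟩ := fiberNorm_lt_iff.1 hr
  suffices hspan : ∀ z ∈ Submodule.span ℂ _, ‖u k‖ ≤ ‖ι u + z‖ from
    lt_of_le_of_lt (closure_minimal hspan hclosed hy) hlt
  refine fun z hz => le_of_forall_pos_le_add fun δ hδ => ?_
  obtain ⟨e, he, hek, hez⟩ := exists_norm_mul_le_of_mem_span hι hψ hz hδ
  calc ‖u k‖ = ‖(e * u) k‖ := by rw [ContinuousMap.mul_apply, hek, one_mul]
    _ ≤ ‖ι (e * u)‖ := (ContinuousMap.norm_coe_le_norm _ k).trans_eq (hnorm _).symm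
    _ = ‖ι e * (ι u + z) - ι e * z‖ := by rw [mul_add, add_sub_cancel_right, map_mul]
    _ ≤ ‖ι e‖ * ‖ι u + z‖ + ‖ι e * z‖ :=
      (norm_sub_le _ _).trans (add_le_add_left (norm_mul_le _ _) _)
    _ ≤ 1 * ‖ι u + z‖ + δ := by rw [hnorm]; gcongr
    _ = ‖ι u + z‖ + δ := by rw [one_mul]

theorem map_mul_sub_smul_mem_jetKernel (hι : Isometry ι) (hψ : Continuous ψ)
    (hdense : DenseRange ψ) (f : C(K, ℂ)) (k : K) (b : B) :
    ι f * b - f k • b ∈ jetKernel (pullbackAction (ι.comp ψ)) 0 (InvSpec.ofPoint hψ k) := by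
  have hιc := hι.continuous
  refine hdense.induction_on f ((isClosed_jetKernel _ 0 _).preimage (by fun_prop)) fun a => ?_
  have h := map_mul_mem_jetKernel (φ := ι.comp ψ)
    (sub_algebraMap_mem_charIdeal (InvSpec.ofPoint hψ k) a) b
  rwa [map_sub, AlgHomClass.commutes, sub_mul, ← Algebra.smul_def] at h

theorem jetKernel_eq_top_of_notMem_range [T2Space K] (hι : Continuous ι) (hψ : Continuous ψ)
    {t : InvSpec A} (ht : t ∉ range (InvSpec.ofPoint hψ)) :
    jetKernel (pullbackAction (ι.comp ψ)) 0 t = ⊤ := by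
  let I : Ideal C(K, ℂ) :=
    { carrier := {f | ι f ∈ jetKernel (pullbackAction (ι.comp ψ)) 0 t}
      zero_mem' := by simp
      add_mem' := fun hf hg => by simpa using add_mem hf hg
      smul_mem' := fun g f hf => by simpa [mul_comm g f] using mul_mem_jetKernel_right hf (ι g) }
  have hI : IsClosed (I : Set C(K, ℂ)) := (isClosed_jetKernel _ 0 t).preimage hι
  have hset : ContinuousMap.setOfIdeal I = univ := by
    refine eq_univ_of_forall fun k => ContinuousMap.mem_setOfIdeal.2 ?_
    by_contra! hzero
    refine ht ⟨k, Subtype.ext (StarAlgHom.ext fun a => ?_)⟩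
    have hmem := map_mul_mem_jetKernel (φ := ι.comp ψ) (sub_algebraMap_mem_charIdeal t a) 1
    rw [mul_one] at hmem
    have h : ψ (a - algebraMap ℂ A (t.1 a)) k = 0 := hzero _ hmem
    rwa [map_sub, AlgHomClass.commutes, ContinuousMap.sub_apply, sub_eq_zero] at h
  have hone : (1 : C(K, ℂ)) ∈ I := by
    rw [← ContinuousMap.idealOfSet_ofIdeal_isClosed hI, hset]
    simp [ContinuousMap.mem_idealOfSet]
  refine eq_top_iff.2 fun b _ => ?_
  simpa using mul_mem_jetKernel_right (φ := ι.comp ψ) hone b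

theorem fiberNorm_le_of_forall_ofPoint_eq [T2Space K] (hι : Continuous ι) (hψ : Continuous ψ)
    {b : B} {M : ℝ} (hM : 0 ≤ M) {t : InvSpec A}
    (h : ∀ k, InvSpec.ofPoint hψ k = t → fiberNorm (ι.comp ψ) t b ≤ M) :
    fiberNorm (ι.comp ψ) t b ≤ M := by
  by_cases ht : t ∈ range (InvSpec.ofPoint hψ)
  · obtain ⟨k, hk⟩ := ht
    exact h k hk
  · rwa [fiberNorm_eq_zero_iff.2 (jetKernel_eq_top_of_notMem_range hι hψ ht ▸ Submodule.mem_top)]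

end Points

section Sections

variable {A : Type*} [CommRing A] [Algebra ℂ A] [StarRing A] [UniformSpace A]
variable {B : Type*} [CStarAlgebra B] {φ : A →⋆ₐ[ℂ] B}

theorem norm_le_of_fiberNorm_le (hφ : Continuous φ) (hcenter : range φ ⊆ Set.center B) {b : B}
    {M : ℝ} (hM : 0 ≤ M) (h : ∀ t, fiberNorm φ t b ≤ M) : ‖b‖ ≤ M := by
  have hcomm (a : A) (y : B) : φ a * y = y * φ a := ((hcenter (mem_range_self a)).comm y).eq
  let s : Set B := range φ ∪ {star b * b}
  have hs : ∀ x ∈ s, star x ∈ s := by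
    rintro _ (⟨a, rfl⟩ | rfl)
    · exact Or.inl ⟨star a, map_star φ a⟩
    · exact Or.inr (by simp)
  have hscomm : ∀ x ∈ s, ∀ y ∈ s, x * y = y * x := by
    rintro _ (⟨a, rfl⟩ | rfl) _ (⟨c, rfl⟩ | rfl)
    exacts [hcomm _ _, hcomm _ _, (hcomm _ _).symm, rfl]
  have : IsMulCommutative (StarAlgebra.adjoin ℂ s) :=
    StarAlgebra.isMulCommutative_adjoin ℂ hscomm fun x hx y hy => hscomm x hx _ (hs y hy)
  obtain ⟨K, _, _, _, ι, ψ, hι, hψ, rfl, hrange⟩ := exists_continuousMap_factorization hφ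
    (subset_union_left.trans (StarAlgebra.subset_adjoin ℂ s))
  obtain ⟨u, hu⟩ : star b * b ∈ range ι :=
    hrange ▸ subset_closure (StarAlgebra.subset_adjoin ℂ s (Or.inr rfl))
  have hnorm : ‖u‖ ≤ M ^ 2 := (ContinuousMap.norm_le u (by positivity)).2 fun k =>
    calc ‖u k‖ ≤ fiberNorm (ι.comp ψ) (InvSpec.ofPoint hψ k) (star b * b) :=
          hu ▸ norm_apply_le_fiberNorm hι hψ u k
      _ ≤ fiberNorm (ι.comp ψ) (InvSpec.ofPoint hψ k) b ^ 2 := fiberNorm_star_mul_self_le hcenter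
      _ ≤ M ^ 2 := by gcongr; exact h _
  refine le_of_sq_le_sq ?_ hM
  calc ‖b‖ ^ 2 = ‖ι u‖ := by rw [hu, CStarRing.norm_star_mul_self, sq]
    _ = ‖u‖ := hι.norm_map_of_map_zero (map_zero ι) u
    _ ≤ M ^ 2 := hnorm

theorem eq_of_forall_jetAt_eq (hφ : Continuous φ) (hcenter : range φ ⊆ Set.center B) {b c : B}
    (h : ∀ t, jetAt (pullbackAction φ) 0 b t = jetAt (pullbackAction φ) 0 c t) : b = c :=
  sub_eq_zero.1 <| norm_le_zero_iff.1 <| norm_le_of_fiberNorm_le hφ hcenter le_rfl fun t =>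
    (fiberNorm_eq_zero_iff.2 (jetAt_eq_jetAt_iff.1 (h t))).le

theorem jet_injective (hφ : Continuous φ) (hcenter : range φ ⊆ Set.center B) :
    Function.Injective (jet (pullbackAction φ) 0) := fun _ _ h =>
  eq_of_forall_jetAt_eq hφ hcenter fun t => eq_of_heq (JetBundle.mk.inj (congrFun h t)).2

universe u in
theorem exists_dense_factorization {B : Type u} [CStarAlgebra B] {φ : A →⋆ₐ[ℂ] B}
    (hφ : Continuous φ) (hcenter : range φ ⊆ Set.center B) :
    ∃ (K : Type u) (_ : TopologicalSpace K) (_ : CompactSpace K) (_ : T2Space K)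
      (ι : C(K, ℂ) →⋆ₐ[ℂ] B) (ψ : A →⋆ₐ[ℂ] C(K, ℂ)),
      Isometry ι ∧ Continuous ψ ∧ DenseRange ψ ∧ ι.comp ψ = φ := by
  have : IsMulCommutative φ.range :=
    ⟨⟨fun x y => Subtype.ext ((hcenter x.2).comm y.1).eq⟩⟩
  obtain ⟨K, _, _, _, ι, ψ, hι, hψ, rfl, hrange⟩ :=
    exists_continuousMap_factorization hφ (S := φ.range) subset_rfl
  refine ⟨K, _, ‹_›, ‹_›, ι, ψ, hι, hψ, fun f => ?_, rfl⟩
  rw [hι.isEmbedding.closure_eq_preimage_closure_image, mem_preimage, ← range_comp]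
  exact hrange.le (mem_range_self f)

theorem eventually_fiberNorm_sub_lt {Z : Type*} [TopologicalSpace Z] {c : Z → B}
    {τ : Z → InvSpec A} (hc : Continuous fun z => jet (pullbackAction φ) 0 (c z) (τ z)) (z₀ : Z)
    {ε : ℝ} (hε : 0 < ε) : ∀ᶠ z in 𝓝 z₀, fiberNorm φ (τ z) (c z - c z₀) < ε := by
  have hnorm : Continuous (normSeminorm ℂ B) := continuous_norm
  have hopen := (isOpen_jetBasicOpen (c z₀) isOpen_univ hnorm hε).preimage hc
  have hmem : jet (pullbackAction φ) 0 (c z₀) (τ z₀) ∈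
      jetBasicOpen (pullbackAction φ) 0 (c z₀) univ (normSeminorm ℂ B) ε := by
    simpa [jet_mem_jetBasicOpen_iff hnorm] using hε
  filter_upwards [hopen.mem_nhds hmem] with z hz
  exact ((jet_mem_jetBasicOpen_iff hnorm).1 hz).2

theorem continuous_of_continuous_jet (hφ : Continuous φ) (hcenter : range φ ⊆ Set.center B)
    [IsUniformAddGroup A] {Z : Type*} [TopologicalSpace Z] {f : Z → B}
    (hf : Continuous fun z : Z × InvSpec A => jet (pullbackAction φ) 0 (f z.1) z.2) :
    Continuous f := by
  obtain ⟨K, _, _, _, ι, ψ, hι, hψ, -, rfl⟩ := exists_dense_factorization hφ hcenter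
  refine continuous_iff_continuousAt.2 fun z₀ => Metric.tendsto_nhds.2 fun ε hε => ?_
  have hlt : ∀ᶠ z in 𝓝 z₀, ∀ k ∈ (univ : Set K),
      fiberNorm (ι.comp ψ) (InvSpec.ofPoint hψ k) (f z - f z₀) < ε / 2 := by
    refine isCompact_univ.eventually_forall_of_forall_eventually fun k _ => ?_
    have hcont := hf.comp (continuous_id.prodMap (InvSpec.continuous_ofPoint hψ))
    exact eventually_fiberNorm_sub_lt (c := fun w : Z × K => f w.1)
      (τ := fun w => InvSpec.ofPoint hψ w.2) hcont (z₀, k) (half_pos hε)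
  filter_upwards [hlt] with z hz
  rw [dist_eq_norm]
  refine (norm_le_of_fiberNorm_le hφ hcenter (half_pos hε).le fun t =>
    fiberNorm_le_of_forall_ofPoint_eq hι.continuous hψ (half_pos hε).le ?_).trans_lt
      (half_lt_self hε)
  rintro k rfl
  exact (hz k (mem_univ k)).le

theorem exists_finset_seminorm_sub_sum_le {K : Type*} [TopologicalSpace K] [CompactSpace K]
    [T2Space K] {V : Type*} [AddCommGroup V] [Module ℂ V] {q : K → Seminorm ℂ V} {c : K → V}
    {ε : ℝ} (hc : ∀ k, ∀ᶠ l in 𝓝 k, q l (c l - c k) ≤ ε) :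
    ∃ (F : Finset K) (f : F → C(K, ℂ)), ∀ l, q l (c l - ∑ i, f i l • c i) ≤ ε := by
  obtain ⟨F, hF⟩ := isCompact_univ.elim_finite_subcover
    (fun k => interior {l | q l (c l - c k) ≤ ε}) (fun k => isOpen_interior)
    fun k _ => mem_iUnion.2 ⟨k, mem_interior_iff_mem_nhds.2 (hc k)⟩
  obtain ⟨f, hf⟩ := PartitionOfUnity.exists_isSubordinate isClosed_univ
    (fun k : F => interior {l | q l (c l - c k) ≤ ε}) (fun k => isOpen_interior)
    (by simpa [iUnion_subtype] using hF)
  refine ⟨F, fun i => ⟨fun l => (f i l : ℂ), by fun_prop⟩, fun l => ?_⟩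
  have hmem : ∑ᶠ i, f i l • c i ∈ (q l).closedBall (c l) ε :=
    f.finsum_smul_mem_convex (g := fun i _ => c i) (mem_univ l) (fun i hi => ?_)
      ((q l).convex_closedBall (c l) ε)
  · rw [finsum_eq_sum_of_fintype, Seminorm.mem_closedBall, map_sub_rev] at hmem
    simpa using hmem
  · rw [Seminorm.mem_closedBall, map_sub_rev]
    exact interior_subset (s := {l | q l (c l - c i) ≤ ε}) (hf i (subset_tsupport _ hi))

theorem exists_forall_fiberNorm_sub_le (hφ : Continuous φ) (hcenter : range φ ⊆ Set.center B)
    [IsUniformAddGroup A] {c : InvSpec A → B}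
    (hc : Continuous fun t => jet (pullbackAction φ) 0 (c t) t) {ε : ℝ} (hε : 0 < ε) :
    ∃ b, ∀ t, fiberNorm φ t (c t - b) ≤ ε := by
  obtain ⟨K, _, _, _, ι, ψ, hι, hψ, hdense, rfl⟩ := exists_dense_factorization hφ hcenter
  have hcK := hc.comp (InvSpec.continuous_ofPoint hψ)
  obtain ⟨F, f, hf⟩ := exists_finset_seminorm_sub_sum_le
    (q := fun k => fiberNorm (ι.comp ψ) (InvSpec.ofPoint hψ k))
    fun k => (eventually_fiberNorm_sub_lt hcK k hε).mono fun _ => le_of_lt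
  refine ⟨∑ i, ι (f i) * c (InvSpec.ofPoint hψ i), fun t =>
    fiberNorm_le_of_forall_ofPoint_eq hι.continuous hψ hε.le ?_⟩
  rintro k rfl
  refine (fiberSeminorm_congr ?_).trans_le (hf k)
  rw [sub_sub_sub_cancel_left, ← Finset.sum_sub_distrib, ← neg_mem_iff, ← Finset.sum_neg_distrib]
  refine sum_mem fun i _ => ?_
  rw [neg_sub]
  exact map_mul_sub_smul_mem_jetKernel hι hψ hdense (f i) k _

theorem exists_forall_fiberNorm_sub_eq_zero (hφ : Continuous φ) (hcenter : range φ ⊆ Set.center B)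
    {c : InvSpec A → B} (h : ∀ ε > 0, ∃ b, ∀ t, fiberNorm φ t (c t - b) ≤ ε) :
    ∃ b, ∀ t, fiberNorm φ t (c t - b) = 0 := by
  choose b hb using fun N : ℕ => h (1 / ((N : ℝ) + 1)) Nat.one_div_pos_of_nat
  have hlim := tendsto_one_div_add_atTop_nhds_zero_nat (𝕜 := ℝ)
  have hcauchy : CauchySeq b := by
    refine cauchySeq_of_le_tendsto_0 (fun N : ℕ => 1 / ((N : ℝ) + 1) + 1 / ((N : ℝ) + 1))
      (fun m l N hm hl => ?_) (by simpa using hlim.add hlim)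
    rw [dist_eq_norm]
    refine norm_le_of_fiberNorm_le hφ hcenter (by positivity) fun t => ?_
    calc fiberNorm φ t (b m - b l) = fiberNorm φ t ((c t - b l) - (c t - b m)) := by
          rw [sub_sub_sub_cancel_left]
      _ ≤ fiberNorm φ t (c t - b l) + fiberNorm φ t (c t - b m) := map_sub_le_add _ _ _
      _ ≤ _ := add_le_add ((hb l t).trans (Nat.one_div_le_one_div hl))
        ((hb m t).trans (Nat.one_div_le_one_div hm))
  obtain ⟨x, hx⟩ := cauchySeq_tendsto_of_complete hcauchy
  refine ⟨x, fun t => ?_⟩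
  have hle (N : ℕ) : fiberNorm φ t (c t - x) ≤ 1 / ((N : ℝ) + 1) + ‖b N - x‖ :=
    calc fiberNorm φ t (c t - x) = fiberNorm φ t ((c t - b N) + (b N - x)) := by
          rw [sub_add_sub_cancel]
      _ ≤ fiberNorm φ t (c t - b N) + fiberNorm φ t (b N - x) := map_add_le_add _ _ _
      _ ≤ _ := add_le_add (hb N t) (fiberNorm_le_norm φ t _)
  have hzero : fiberNorm φ t (c t - x) ≤ 0 := ge_of_tendsto'
    (by simpa using hlim.add (tendsto_iff_norm_sub_tendsto_zero.1 hx)) hle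
  exact hzero.antisymm (apply_nonneg _ _)

theorem exists_forall_jetAt_eq (hφ : Continuous φ) (hcenter : range φ ⊆ Set.center B)
    [IsUniformAddGroup A] {v : ∀ t : InvSpec A, JetFiber (pullbackAction φ) 0 t}
    (hv : Continuous fun t => (⟨t, v t⟩ : JetBundle (pullbackAction φ) 0)) :
    ∃ b : B, ∀ t, jetAt (pullbackAction φ) 0 b t = v t := by
  choose c hc using fun t => jetAt_surjective (pullbackAction φ) 0 t (v t)
  have hcont : Continuous fun t => jet (pullbackAction φ) 0 (c t) t := by
    simpa only [jet, hc] using hv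
  obtain ⟨b, hb⟩ := exists_forall_fiberNorm_sub_eq_zero hφ hcenter fun ε hε =>
    exists_forall_fiberNorm_sub_le hφ hcenter hcont hε
  refine ⟨b, fun t => ?_⟩
  rw [← hc, eq_comm, jetAt_eq_jetAt_iff, ← fiberNorm_eq_zero_iff]
  exact hb t

end Sections

section Operator

variable {A : Type*} [CommRing A] [Algebra ℂ A] [StarRing A] [UniformSpace A]
variable {X : Type*} [AddCommGroup X] [Module ℂ X] [UniformSpace X] [IsUniformAddGroup X]
  [ContinuousSMul ℂ X]
variable {B : Type*} [CStarAlgebra B] {ρ : A →ₐ[ℂ] Module.End ℂ X} {φ : A →⋆ₐ[ℂ] B} {n : ℕ}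

theorem exists_continuousLinearMap_jet_eq [IsUniformAddGroup A] (hφ : Continuous φ)
    (hcenter : range φ ⊆ Set.center B) (μ : JetBundleHom ρ n (pullbackAction φ) 0) :
    ∃ D : X →L[ℂ] B, ∀ x, jet (pullbackAction φ) 0 (D x) = μ.toFun ∘ jet ρ n x := by
  have hμ (x : X) : μ.toFun ∘ jet ρ n x = fun t => ⟨t, μ.fiberMap t (jetAt ρ n x t)⟩ :=
    funext fun t => μ.toFun_mk t _
  have hcont : Continuous fun z : X × InvSpec A => (μ.toFun ∘ jet ρ n z.1) z.2 :=
    μ.continuous_toFun.comp (continuous_jet ρ n)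
  choose d hd using fun x => exists_forall_jetAt_eq hφ hcenter
    (v := fun t => μ.fiberMap t (jetAt ρ n x t)) (hμ x ▸ hcont.comp (Continuous.prodMk_right x))
  have hjet (x : X) : jet (pullbackAction φ) 0 (d x) = μ.toFun ∘ jet ρ n x := by
    rw [hμ]
    exact funext fun t => JetBundle.ext rfl (heq_of_eq (hd x t))
  have hdₗ (x : X) (t : InvSpec A) : jetAtₗ (pullbackAction φ) 0 t (d x) =
      μ.fiberMap t (jetAtₗ ρ n t x) := hd x t
  have hext {b c : B} (h : ∀ t, jetAtₗ (pullbackAction φ) 0 t b =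
      jetAtₗ (pullbackAction φ) 0 t c) : b = c := eq_of_forall_jetAt_eq hφ hcenter h
  let D : X →ₗ[ℂ] B :=
    { toFun := d
      map_add' := fun x y => hext fun t => by simp only [map_add, hdₗ]
      map_smul' := fun c x => hext fun t => by simp only [map_smul, hdₗ, RingHom.id_apply] }
  have hD : Continuous D := continuous_of_continuous_jet hφ hcenter
    (hcont.congr fun z => congrFun (hjet z.1).symm z.2)
  exact ⟨⟨D, hD⟩, hjet⟩

theorem isDiffOp_of_jetKernel_le_comap (hφ : Continuous φ) (hcenter : range φ ⊆ Set.center B)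
    {D : X →L[ℂ] B}
    (hD : ∀ t, jetKernel ρ n t ≤ (jetKernel (pullbackAction φ) 0 t).comap D.toLinearMap) :
    IsDiffOp ρ (pullbackAction φ) n D := fun l hl =>
  LinearMap.ext fun x => eq_of_forall_jetAt_eq hφ hcenter fun t => jetAt_eq_jetAt_iff.2 <| by
    rw [LinearMap.zero_apply, sub_zero]
    refine foldl_moduleCommutator_mem_jetKernel l (fun a ha x => ?_) x
    rw [hl] at ha
    exact hD t (apply_mem_jetKernel ρ n ha x)

theorem jetKernel_le_comap_of_jet_eq {μ : JetBundleHom ρ n (pullbackAction φ) 0} {D : X →ₗ[ℂ] B}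
    (hD : ∀ x, jet (pullbackAction φ) 0 (D x) = μ.toFun ∘ jet ρ n x) (t : InvSpec A) :
    jetKernel ρ n t ≤ (jetKernel (pullbackAction φ) 0 t).comap D := by
  have hjetAt (x : X) : jetAtₗ (pullbackAction φ) 0 t (D x) = μ.fiberMap t (jetAtₗ ρ n t x) :=
    eq_of_heq (JetBundle.mk.inj ((congrFun (hD x) t).trans (μ.toFun_mk t _))).2
  intro x hx
  rw [← ker_jetAtₗ, LinearMap.mem_ker] at hx
  rw [Submodule.mem_comap, ← ker_jetAtₗ, LinearMap.mem_ker, hjetAt, hx, map_zero]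

end Operator

end

theorem mainTheorem9_general
    {A : Type*} [CommRing A] [Algebra ℂ A] [StarRing A] [UniformSpace A] [IsUniformAddGroup A]
    {X : Type*} [AddCommGroup X] [Module ℂ X] [UniformSpace X] [IsUniformAddGroup X]
    [ContinuousSMul ℂ X] (ρ : A →ₐ[ℂ] Module.End ℂ X)
    {B : Type*} [CStarAlgebra B]
    (φ : A →⋆ₐ[ℂ] B) (hφ : Continuous φ)
    (hcenter : Set.range φ ⊆ Set.center B)
    (n : ℕ) (μ : JetBundleHom ρ n (pullbackAction φ) 0) :
    ∃! D : X →L[ℂ] B,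
      IsDiffOp ρ (pullbackAction φ) n D ∧
        ∀ x : X, jet (pullbackAction φ) 0 (D x) = μ.toFun ∘ jet ρ n x := by
  obtain ⟨D, hD⟩ := exists_continuousLinearMap_jet_eq hφ hcenter μ
  refine ⟨D, ⟨isDiffOp_of_jetKernel_le_comap hφ hcenter (jetKernel_le_comap_of_jet_eq hD), hD⟩, ?_⟩
  rintro D' ⟨-, hD'⟩
  exact ContinuousLinearMap.ext fun x =>
    jet_injective hφ hcenter ((hD' x).trans (hD x).symm)

theorem mainTheorem9
    {A : Type*} [CommRing A] [Algebra ℂ A] [StarRing A] [StarModule ℂ A]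
    [UniformSpace A] [IsUniformAddGroup A] [ContinuousSMul ℂ A] [ContinuousStar A]
    (hA : IsStereotypeAlgebra A)
    {B : Type*} [CStarAlgebra B]
    (φ : A →⋆ₐ[ℂ] B) (hφ : Continuous φ)
    (hcenter : Set.range φ ⊆ Set.center B)
    (n : ℕ) (μ : JetBundleHom (selfAction A) n (pullbackAction φ) 0) :
    ∃! D : A →L[ℂ] B,
      IsDiffOp (selfAction A) (pullbackAction φ) n D ∧
        ∀ x : A, jet (pullbackAction φ) 0 (D x) = μ.toFun ∘ jet (selfAction A) n x :=
  mainTheorem9_general (selfAction A) φ hφ hcenter n μ
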